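/- All rings are commutative with identity and $n\ge 0$ is an integer. A module $M$ over a ring $R$ is called *strongly $n$-Gorenstein projective* if there is a short exact sequence $0\to M\to P\to M\to 0$ of $R$-modules with $\operatorname{pd}_R(P)\le n$, and $\operatorname{Ext}_R^{n+1}(M,Q)=0$ for every projective $R$-module $Q$. It is called *strongly $n$-Gorenstein flat* if there is a short exact sequence $0\to M\to F\to M\to 0$ of $R$-modules with $\operatorname{fd}_R(F)\le n$, and $\operatorname{Tor}^R_{n+1}(M,I)=0$ for every injective $R$-module $I$. The ring $R$ is *$n$-SG* if every $R$-module is strongly $n$-Gorenstein projective, and *$n$-wSG* if every $R$-module is strongly $n$-Gorenstein flat. A ring is *coherent* if each of its finitely generated ideals is finitely presented. **Theorem 2.8.** Let $\{R_i\}_{i=1}^m$ be a finite family of rings and set $R:=\prod_{i=1}^m R_i$. Then $R$ is an $n$-SG ring if and only if $R_i$ is an $n$-SG ring for each $i$. Moreover, if $R_i$ is coherent for each $i$, then $R$ is an $n$-wSG ring if and only if $R_i$ is an $n$-wSG ring for each $i$. -/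

import Mathlib

open CategoryTheory

universe u

/-- `R` is coherent: every finitely generated ideal is finitely presented as an `R`-module. -/
def IsCoherentRing (R : Type u) [CommRing R] : Prop :=
  ∀ I : Ideal R, I.FG → Module.FinitePresentation R I

/-- `fd_R(M) ≤ n`: there is an exact sequence `0 → F_n → ⋯ → F_0 → M → 0` with every `F_j` flat.
The sequence is cut into short exact sequences `0 → K → F → M → 0`, with `F` flat and
`fd_R(K) ≤ n - 1`. -/
def HasFlatDimensionLE (R : Type u) [CommRing R] : ℕ → ModuleCat.{u} R → Prop
  | 0, M => Module.Flat R M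
  | n + 1, M => ∃ (K F : ModuleCat.{u} R) (f : K →ₗ[R] F) (g : F →ₗ[R] M),
      Module.Flat R F ∧ Function.Injective f ∧ Function.Exact f g ∧ Function.Surjective g ∧
        HasFlatDimensionLE R n K

/-- `M` is strongly `n`-Gorenstein projective: there is a short exact sequence
`0 → M → P → M → 0` with `pd_R(P) ≤ n`, and `Ext_R^{n+1}(M, Q) = 0` for all projective `Q`. -/
def IsStronglyGorensteinProjective (n : ℕ) (R : Type u) [CommRing R] (M : ModuleCat.{u} R) :
    Prop :=
  (∃ (P : ModuleCat.{u} R) (f : M →ₗ[R] P) (g : P →ₗ[R] M),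
      Function.Injective f ∧ Function.Exact f g ∧ Function.Surjective g ∧
        HasProjectiveDimensionLE P n) ∧
    ∀ Q : ModuleCat.{u} R, Module.Projective R Q → Subsingleton (Abelian.Ext.{u} M Q (n + 1))

/-- `M` is strongly `n`-Gorenstein flat: there is a short exact sequence
`0 → M → F → M → 0` with `fd_R(F) ≤ n`, and `Tor^R_{n+1}(M, I) = 0` for all injective `I`. -/
def IsStronglyGorensteinFlat (n : ℕ) (R : Type u) [CommRing R] (M : ModuleCat.{u} R) : Prop :=
  (∃ (F : ModuleCat.{u} R) (f : M →ₗ[R] F) (g : F →ₗ[R] M),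
      Function.Injective f ∧ Function.Exact f g ∧ Function.Surjective g ∧
        HasFlatDimensionLE R n F) ∧
    ∀ I : ModuleCat.{u} R, Module.Injective R I →
      Limits.IsZero (((Tor (ModuleCat.{u} R) (n + 1)).obj M).obj I)

/-- `R` is `n`-strongly Gorenstein (`n`-SG): every `R`-module is strongly `n`-Gorenstein
projective. -/
def IsSGRing (n : ℕ) (R : Type u) [CommRing R] : Prop :=
  ∀ M : ModuleCat.{u} R, IsStronglyGorensteinProjective n R M

/-- `R` is weakly `n`-strongly Gorenstein (`n`-wSG): every `R`-module is strongly `n`-Gorenstein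
flat. -/
def IsWSGRing (n : ℕ) (R : Type u) [CommRing R] : Prop :=
  ∀ M : ModuleCat.{u} R, IsStronglyGorensteinFlat n R M

/-! Let `A` be the product ring. As an `A`-module each factor `R i` is a direct summand of `A`,
hence projective and flat, so extension along the projection `A → R i` is exact, as restriction
always is. Both functors preserve projectives, injectives and flats, hence bounds on the
corresponding dimensions. Extension undoes restriction, and an `A`-module is the finite product of
its restricted extensions (`piFactorEquiv`). Self-extensions therefore pass both ways: extend them
to a factor, or restrict them from all factors and take the product. The Ext condition, imposed for
all `M` at once, says that projectives have injective dimension at most `n` (`isSGRing_iff`), so it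
transports like the other dimensions. The Tor condition transports because extension commutes with
Tor (`nonempty_obj_tor_iso`) and an `A`-module whose extensions all vanish is zero. -/

/-! ### Homological dimensions under exact functors and decompositions of the identity. -/

section DimensionTransport

open CategoryTheory.Limits

universe v v' u'

variable {C : Type u} [Category.{v} C] [Abelian C] {D : Type u'} [Category.{v'} D] [Abelian D]

/-- An exact functor preserving projective objects does not increase the projective dimension. -/
lemma CategoryTheory.Functor.hasProjectiveDimensionLE_obj [EnoughProjectives C] (F : C ⥤ D)
    [F.Additive] [PreservesFiniteLimits F] [PreservesFiniteColimits F]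
    [F.PreservesProjectiveObjects] (n : ℕ) (X : C)
    (h : HasProjectiveDimensionLE X n) :
    HasProjectiveDimensionLE (F.obj X) n := by
  induction n generalizing X with
  | zero =>
    have : Projective X := (projective_iff_hasProjectiveDimensionLE_zero _).2 h
    exact (projective_iff_hasProjectiveDimensionLE_zero _).1 (F.projective_obj X)
  | succ n ih =>
    let ⟨p⟩ := EnoughProjectives.presentation X
    have hS : (ShortComplex.mk _ _ (kernel.condition p.f)).ShortExact :=
      { exact := ShortComplex.exact_kernel p.f }
    have := (hS.hasProjectiveDimensionLT_X₃_iff n p.projective).1 h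
    exact ((hS.map_of_exact F).hasProjectiveDimensionLT_X₃_iff n (F.projective_obj p.p)).2 (ih _ this)

/-- An exact functor preserving injective objects does not increase the injective dimension. -/
lemma CategoryTheory.Functor.hasInjectiveDimensionLE_obj [EnoughInjectives C] (F : C ⥤ D)
    [F.Additive] [PreservesFiniteLimits F] [PreservesFiniteColimits F]
    [F.PreservesInjectiveObjects] (n : ℕ) (X : C)
    (h : HasInjectiveDimensionLE X n) :
    HasInjectiveDimensionLE (F.obj X) n := by
  induction n generalizing X with
  | zero =>
    have : Injective X := injective_iff_hasInjectiveDimensionLT_one.2 h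
    exact injective_iff_hasInjectiveDimensionLT_one.1 (F.injective_obj X)
  | succ n ih =>
    let ⟨p⟩ := EnoughInjectives.presentation X
    have hS : (ShortComplex.mk _ _ (cokernel.condition p.f)).ShortExact :=
      { exact := ShortComplex.exact_cokernel p.f }
    have := (hS.hasInjectiveDimensionLT_X₃_iff n p.injective).2 h
    exact ((hS.map_of_exact F).hasInjectiveDimensionLT_X₃_iff n (F.injective_obj p.J)).1 (ih _ this)

variable {ι : Type*} [Fintype ι] {X : C} {Y : ι → C} (p : ∀ i, X ⟶ Y i) (s : ∀ i, Y i ⟶ X)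

/-- Inserting the decomposed identity writes a class in `Ext X Z` as a sum of classes that factor
through `Ext (Y i) Z`. No orthogonality between the summands is needed. -/
lemma hasProjectiveDimensionLE_of_sum_comp_eq_id (h : ∑ i, p i ≫ s i = 𝟙 X) (n : ℕ)
    (hY : ∀ i, HasProjectiveDimensionLE (Y i) n) : HasProjectiveDimensionLE X n := by
  let := HasExt.standard C
  rw [HasProjectiveDimensionLE, hasProjectiveDimensionLT_iff]
  intro k hk Z e
  have he : (Abelian.Ext.mk₀ (∑ i, p i ≫ s i)).comp e (zero_add k) = e := by simp [h]
  rw [← he, Abelian.Ext.mk₀_sum, Abelian.Ext.sum_comp]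
  refine Finset.sum_eq_zero fun i _ => ?_
  rw [← Abelian.Ext.mk₀_comp_mk₀_assoc,
    ((Abelian.Ext.mk₀ (s i)).comp e (zero_add k)).eq_zero_of_hasProjectiveDimensionLT (n + 1) hk,
    Abelian.Ext.comp_zero]

lemma hasInjectiveDimensionLE_of_sum_comp_eq_id (h : ∑ i, p i ≫ s i = 𝟙 X) (n : ℕ)
    (hY : ∀ i, HasInjectiveDimensionLE (Y i) n) : HasInjectiveDimensionLE X n := by
  let := HasExt.standard C
  rw [HasInjectiveDimensionLE, hasInjectiveDimensionLT_iff]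
  intro k hk Z e
  have he : e.comp (Abelian.Ext.mk₀ (∑ i, p i ≫ s i)) (add_zero k) = e := by simp [h]
  rw [← he, Abelian.Ext.mk₀_sum, Abelian.Ext.comp_sum]
  refine Finset.sum_eq_zero fun i _ => ?_
  rw [← Abelian.Ext.mk₀_comp_mk₀, ← Abelian.Ext.comp_assoc_of_third_deg_zero,
    (e.comp (Abelian.Ext.mk₀ (p i)) (add_zero k)).eq_zero_of_hasInjectiveDimensionLT (n + 1) hk,
    Abelian.Ext.zero_comp]

end DimensionTransport

/-! ### Tor under exact monoidal functors. -/

section Tor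

open CategoryTheory.Limits MonoidalCategory

universe v v' u'

variable {C : Type u} [Category.{v} C] [MonoidalCategory C] [Abelian C] [MonoidalPreadditive C]
  [HasProjectiveResolutions C] {D : Type u'} [Category.{v'} D] [MonoidalCategory D] [Abelian D]
  [MonoidalPreadditive D] [HasProjectiveResolutions D]

/-- An exact monoidal functor preserving projective objects commutes with `Tor`. -/
lemma CategoryTheory.Functor.nonempty_obj_tor_iso (F : C ⥤ D) [F.Monoidal] [F.Additive]
    [F.PreservesHomology] [F.PreservesProjectiveObjects] (n : ℕ) (X Y : C) :
    Nonempty (F.obj (((Tor C n).obj X).obj Y) ≅ ((Tor D n).obj (F.obj X)).obj (F.obj Y)) := by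
  -- `Tor` derives `X ⊗ -`, so the second variable is resolved; `F` sends `P` to a projective
  -- resolution of `F.obj Y`.
  let P := projectiveResolution Y
  let K := (((tensoringLeft C).obj X).mapHomologicalComplex _).obj P.complex
  let e₁ := F.mapIso (P.isoLeftDerivedObj ((tensoringLeft C).obj X) n)
  let e₂ : F.obj (K.homology n) ≅ ((F.mapHomologicalComplex _).obj K).homology n :=
    ((K.sc n).mapHomologyIso F).symm
  let e₃ : (F.mapHomologicalComplex _).obj K ≅
      (((tensoringLeft D).obj (F.obj X)).mapHomologicalComplex _).obj
        (F.mapProjectiveResolution P).complex :=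
    HomologicalComplex.Hom.isoOfComponents
      (fun i => (Functor.Monoidal.commTensorLeft F X).symm.app (P.complex.X i))
      (fun i j _ => ((Functor.Monoidal.commTensorLeft F X).inv.naturality _).symm)
  exact ⟨e₁ ≪≫ e₂ ≪≫ (HomologicalComplex.homologyFunctor _ _ n).mapIso e₃ ≪≫
    ((F.mapProjectiveResolution P).isoLeftDerivedObj ((tensoringLeft D).obj (F.obj X)) n).symm⟩

end Tor

/-- `M` is an `S`-summand of a free `S`-module, which over `R` is a direct sum of copies of the
projective module `S`. -/
lemma Module.Projective.trans (R S M : Type*) [CommRing R] [CommRing S] [Algebra R S]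
    [AddCommGroup M] [Module R M] [Module S M] [IsScalarTower R S M] [Module.Projective R S]
    [Module.Projective S M] : Module.Projective R M := by
  obtain ⟨i, hi⟩ := Module.projective_lifting_property
    (Finsupp.linearCombination S (_root_.id : M → M)) LinearMap.id
    (fun m => ⟨Finsupp.single m 1, by simp⟩)
  classical
  have : Module.Projective R (M →₀ S) := .of_equiv (finsuppLequivDFinsupp (M := S) R).symm
  exact Module.Projective.of_split (i.restrictScalars R)
    ((Finsupp.linearCombination S (_root_.id : M → M)).restrictScalars R)
    (LinearMap.ext fun m => LinearMap.congr_fun hi m)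

/-! ### Change of rings along a projection with a linear section. -/

section LinearSection

open CategoryTheory.Limits TensorProduct

variable {R S : Type u} [CommRing R] [CommRing S]

/-- An `R`-linear section of a ring homomorphism `f : R →+* S`; it exhibits `S` as a direct
summand of the `R`-module `R`. -/
structure RingHom.LinearSection (f : R →+* S) where
  /-- The underlying additive map. -/
  toFun : S →+ R
  map_mul : ∀ r x, toFun (f r * x) = r * toFun x
  apply_toFun : ∀ x, f (toFun x) = x

namespace RingHom.LinearSection

variable {f : R →+* S} (s : f.LinearSection)
include s

lemma surjective : Function.Surjective f := fun x => ⟨s.toFun x, s.apply_toFun x⟩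

lemma projective : @Module.Projective R _ S _ f.toAlgebra.toModule := by
  let := f.toAlgebra
  exact Module.Projective.of_split { s.toFun with map_smul' := s.map_mul } (Algebra.linearMap R S)
    (LinearMap.ext s.apply_toFun)

lemma projective_restrictScalars (M : ModuleCat.{u} S) [Module.Projective S M] :
    Module.Projective R ((ModuleCat.restrictScalars f).obj M) := by
  let := f.toAlgebra
  let : Module S ((ModuleCat.restrictScalars f).obj M) := inferInstanceAs (Module S M)
  have : Module.Projective S ((ModuleCat.restrictScalars f).obj M) :=
    inferInstanceAs (Module.Projective S M)
  have : IsScalarTower R S ((ModuleCat.restrictScalars f).obj M) :=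
    ⟨fun r x m => mul_smul (f r) x (show M from m)⟩
  have := s.projective
  exact Module.Projective.trans R S _

lemma preservesProjectiveObjects_restrictScalars :
    (ModuleCat.restrictScalars.{u} f).PreservesProjectiveObjects where
  projective_obj {M} hM := by
    have : Module.Projective S M := M.projective_of_module_projective
    have := s.projective_restrictScalars M
    exact ModuleCat.projective_of_categoryTheory_projective _

omit s in
lemma _root_.ModuleCat.preservesInjectiveObjects_restrictScalars
    [(ModuleCat.extendScalars.{u, u, u} f).PreservesMonomorphisms] :
    (ModuleCat.restrictScalars.{u} f).PreservesInjectiveObjects where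
  injective_obj {M} hM := (ModuleCat.extendRestrictScalarsAdj f).map_injective M hM

lemma flat : @Module.Flat R S _ _ f.toAlgebra.toModule :=
  let := f.toAlgebra
  have := s.projective
  inferInstance

lemma flat_restrictScalars (M : ModuleCat.{u} S) [Module.Flat S M] :
    Module.Flat R ((ModuleCat.restrictScalars f).obj M) := by
  let := f.toAlgebra
  let : Module S ((ModuleCat.restrictScalars f).obj M) := inferInstanceAs (Module S M)
  have : Module.Flat S ((ModuleCat.restrictScalars f).obj M) := inferInstanceAs (Module.Flat S M)
  have : IsScalarTower R S ((ModuleCat.restrictScalars f).obj M) :=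
    ⟨fun r x m => mul_smul (f r) x (show M from m)⟩
  have := s.flat
  exact Module.Flat.trans R S _

omit s in
lemma _root_.ModuleCat.flat_extendScalars (f : R →+* S) (M : ModuleCat.{u} R) [Module.Flat R M] :
    Module.Flat S ((ModuleCat.extendScalars f).obj M) := by
  let := f.toAlgebra
  exact Module.Flat.baseChange R S M

lemma extendScalars_map_exact (T : ShortComplex (ModuleCat.{u} R)) (h : T.Exact) :
    (T.map (ModuleCat.extendScalars.{u, u, u} f)).Exact := by
  rw [ShortComplex.ShortExact.moduleCat_exact_iff_function_exact] at h ⊢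
  let := f.toAlgebra
  have := s.flat
  exact Module.Flat.lTensor_exact S h

lemma preservesFiniteLimits_extendScalars :
    PreservesFiniteLimits (ModuleCat.extendScalars.{u, u, u} f) :=
  have := (ModuleCat.extendRestrictScalarsAdj f).left_adjoint_additive
  have h : PreservesFiniteLimits _ ∧ PreservesFiniteColimits _ :=
    ((ModuleCat.extendScalars.{u, u, u} f).exact_tfae.out 1 3).1 s.extendScalars_map_exact
  h.1

lemma preservesFiniteColimits_extendScalars :
    PreservesFiniteColimits (ModuleCat.extendScalars.{u, u, u} f) :=
  have := (ModuleCat.extendRestrictScalarsAdj f).left_adjoint_additive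
  have h : PreservesFiniteLimits _ ∧ PreservesFiniteColimits _ :=
    ((ModuleCat.extendScalars.{u, u, u} f).exact_tfae.out 1 3).1 s.extendScalars_map_exact
  h.2

lemma full_restrictScalars : (ModuleCat.restrictScalars.{u} f).Full where
  map_surjective {M N} g := by
    refine ⟨ModuleCat.ofHom
      { toFun := g.hom, map_add' := g.hom.map_add, map_smul' := fun x m => ?_ }, rfl⟩
    obtain ⟨r, rfl⟩ := s.surjective x
    exact g.hom.map_smul r m

/-- Since `f` is surjective, restriction is fully faithful, so the counit is invertible. -/
lemma nonempty_extendScalars_restrictScalars_iso (M : ModuleCat.{u} S) :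
    Nonempty ((ModuleCat.extendScalars f).obj ((ModuleCat.restrictScalars f).obj M) ≅ M) := by
  have := s.full_restrictScalars
  exact ⟨(asIso (ModuleCat.extendRestrictScalarsAdj f).counit).app M⟩

/-- The map `S ⊗ M → M`, `x ⊗ m ↦ s x • m`. -/
noncomputable def fromExtend (M : ModuleCat.{u} R) :
    (ModuleCat.restrictScalars f).obj ((ModuleCat.extendScalars f).obj M) ⟶ M :=
  letI := f.toAlgebra
  let t : S →ₗ[R] R := { s.toFun with map_smul' := s.map_mul }
  let q : S ⊗[R] M →ₗ[R] M := (TensorProduct.lid R M).toLinearMap ∘ₗ t.rTensor M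
  ModuleCat.ofHom
    (X := (ModuleCat.restrictScalars f).obj ((ModuleCat.extendScalars f).obj M))
    { toFun := fun z => q z
      map_add' := q.map_add
      map_smul' := fun r z => by
        change q (algebraMap R S r • (show S ⊗[R] M from z)) = r • q z
        rw [algebraMap_smul]
        exact q.map_smul r z }

/-- The map `M → S ⊗ M`, `m ↦ 1 ⊗ m`. -/
noncomputable abbrev _root_.ModuleCat.toExtend (f : R →+* S) (M : ModuleCat.{u} R) :
    M ⟶ (ModuleCat.restrictScalars f).obj ((ModuleCat.extendScalars f).obj M) :=
  (ModuleCat.extendRestrictScalarsAdj f).unit.app M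

lemma fromExtend_tmul (M : ModuleCat.{u} R) (x : S) (m : M) :
    letI := f.toAlgebra
    (s.fromExtend M).hom (x ⊗ₜ[R] m : S ⊗[R] M) = s.toFun x • m := rfl

/-- `S ⊗ M` is a direct summand of `M`. -/
lemma fromExtend_comp_toExtend (M : ModuleCat.{u} R) :
    s.fromExtend M ≫ ModuleCat.toExtend f M = 𝟙 _ := by
  let := f.toAlgebra
  ext z
  change (ModuleCat.toExtend f M).hom ((s.fromExtend M).hom z) = z
  induction (show S ⊗[R] M from z) using TensorProduct.induction_on with
  | zero => exact (congrArg _ (map_zero _)).trans (map_zero _)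
  | tmul x m =>
    rw [fromExtend_tmul]
    change (1 : S) ⊗ₜ[R] (s.toFun x • m) = x ⊗ₜ[R] m
    -- Moved across the tensor, the scalar `s.toFun x` acts on `S` as `f (s.toFun x) = x`.
    rw [← TensorProduct.smul_tmul, Algebra.smul_def, mul_one]
    exact congrArg (· ⊗ₜ[R] m) (s.apply_toFun x)
  | add z w hz hw =>
    refine (congrArg _ (map_add (s.fromExtend M).hom z w)).trans ((map_add _ _ _).trans ?_)
    exact congrArg₂ (· + ·) hz hw

/-- Restriction reflects injectivity, and the restricted extension of `M` is a retract of `M`. -/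
lemma preservesInjectiveObjects_extendScalars :
    (ModuleCat.extendScalars.{u, u, u} f).PreservesInjectiveObjects where
  injective_obj {M} hM := by
    have := s.full_restrictScalars
    refine (ModuleCat.restrictScalars f).injective_of_map_injective ?_
    exact Retract.injective (Y := M)
      { i := s.fromExtend M, r := ModuleCat.toExtend f M, retract := s.fromExtend_comp_toExtend M }

omit s in
lemma _root_.ModuleCat.preservesProjectiveObjects_extendScalars (f : R →+* S) :
    (ModuleCat.extendScalars.{u, u, u} f).PreservesProjectiveObjects where
  projective_obj {M} hM := (ModuleCat.extendRestrictScalarsAdj f).map_projective M hM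

end RingHom.LinearSection

end LinearSection

/-! ### Self-extensions, flat dimension and the global form of the ring conditions. -/

section SelfExtension

open CategoryTheory.Limits

variable {R S : Type u} [CommRing R] [CommRing S]

lemma ModuleCat.exact_map (F : ModuleCat.{u} R ⥤ ModuleCat.{u} S) [F.Additive]
    [PreservesFiniteLimits F] [PreservesFiniteColimits F] {K M N : ModuleCat.{u} R}
    {f : K →ₗ[R] M} {g : M →ₗ[R] N} (hf : Function.Injective f) (hfg : Function.Exact f g)
    (hg : Function.Surjective g) :
    Function.Injective (F.map (ofHom f)).hom ∧
      Function.Exact (F.map (ofHom f)).hom (F.map (ofHom g)).hom ∧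
      Function.Surjective (F.map (ofHom g)).hom := by
  let T : ShortComplex (ModuleCat.{u} R) :=
    ShortComplex.mk (ofHom f) (ofHom g) (by ext x; exact hfg.apply_apply_eq_zero x)
  have hT : T.ShortExact := ModuleCat.shortComplex_shortExact T hfg hf hg
  have h := hT.map_of_exact F
  exact ⟨h.moduleCat_injective_f,
    (ShortComplex.ShortExact.moduleCat_exact_iff_function_exact _).1 h.exact,
    h.moduleCat_surjective_g⟩

/-- There is a short exact sequence `0 → M → P → M → 0` where `P` satisfies `T`. -/
def HasSelfExtension (T : ModuleCat.{u} R → Prop) (M : ModuleCat.{u} R) : Prop :=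
  ∃ (P : ModuleCat.{u} R) (f : M →ₗ[R] P) (g : P →ₗ[R] M),
    Function.Injective f ∧ Function.Exact f g ∧ Function.Surjective g ∧ T P

namespace HasSelfExtension

variable {T : ModuleCat.{u} R → Prop}

lemma map (F : ModuleCat.{u} R ⥤ ModuleCat.{u} S) [F.Additive]
    [PreservesFiniteLimits F] [PreservesFiniteColimits F] {T' : ModuleCat.{u} S → Prop}
    (hT : ∀ P, T P → T' (F.obj P)) {M : ModuleCat.{u} R} (h : HasSelfExtension T M) :
    HasSelfExtension T' (F.obj M) := by
  obtain ⟨P, f, g, hf, hfg, hg, hP⟩ := h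
  obtain ⟨hf', hfg', hg'⟩ := ModuleCat.exact_map F hf hfg hg
  exact ⟨F.obj P, _, _, hf', hfg', hg', hT P hP⟩

lemma of_linearEquiv {M N : ModuleCat.{u} R} (e : M ≃ₗ[R] N) (h : HasSelfExtension T M) :
    HasSelfExtension T N := by
  obtain ⟨P, f, g, hf, hfg, hg, hP⟩ := h
  refine ⟨P, f ∘ₗ e.symm, e ∘ₗ g, hf.comp e.symm.injective, fun x => ?_, e.surjective.comp hg, hP⟩
  refine (by simp : (e.toLinearMap ∘ₗ g) x = 0 ↔ g x = 0).trans ((hfg x).trans ?_)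
  exact ⟨fun ⟨y, hy⟩ => ⟨e y, by simpa using hy⟩, fun ⟨y, hy⟩ => ⟨e.symm y, hy⟩⟩

lemma pi {ι : Type} {M : ι → ModuleCat.{u} R} (h : ∀ i, HasSelfExtension T (M i))
    (hT : ∀ P : ι → ModuleCat.{u} R, (∀ i, T (P i)) → T (ModuleCat.of R (∀ i, P i))) :
    HasSelfExtension T (ModuleCat.of R (∀ i, M i)) := by
  choose P f g hf hfg hg hP using h
  refine ⟨ModuleCat.of R (∀ i, P i), LinearMap.piMap f, LinearMap.piMap g,
    Function.Injective.piMap hf, fun x => ?_, Function.Surjective.piMap hg, hT P hP⟩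
  refine funext_iff.trans ((forall_congr' fun i => hfg i (x i)).trans ?_)
  exact ⟨fun hx => ⟨fun i => (hx i).choose, funext fun i => (hx i).choose_spec⟩,
    fun ⟨y, hy⟩ i => ⟨y i, congrFun hy i⟩⟩

end HasSelfExtension

namespace HasFlatDimensionLE

lemma map (F : ModuleCat.{u} R ⥤ ModuleCat.{u} S) [F.Additive]
    [PreservesFiniteLimits F] [PreservesFiniteColimits F]
    (hF : ∀ M : ModuleCat.{u} R, Module.Flat R M → Module.Flat S (F.obj M)) {n : ℕ}
    {M : ModuleCat.{u} R} (h : HasFlatDimensionLE R n M) : HasFlatDimensionLE S n (F.obj M) := by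
  induction n generalizing M with
  | zero => exact hF M h
  | succ n ih =>
    obtain ⟨K, L, f, g, hL, hf, hfg, hg, hK⟩ := h
    obtain ⟨hf', hfg', hg'⟩ := ModuleCat.exact_map F hf hfg hg
    exact ⟨F.obj K, F.obj L, _, _, hF L hL, hf', hfg', hg', ih hK⟩

lemma pi {ι : Type} [Finite ι] {n : ℕ} {M : ι → ModuleCat.{u} R}
    (h : ∀ i, HasFlatDimensionLE R n (M i)) :
    HasFlatDimensionLE R n (ModuleCat.of R (∀ i, M i)) := by
  classical
  have := Fintype.ofFinite ι
  -- Finiteness of `ι` matters here: the product is a direct sum.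
  have flat (N : ι → ModuleCat.{u} R) (hN : ∀ i, Module.Flat R (N i)) :
      Module.Flat R (∀ i, N i) :=
    .of_linearEquiv (DFinsupp.linearEquivFunOnFintype (R := R) (M := fun i => N i)).symm
  induction n generalizing M with
  | zero => exact flat M h
  | succ n ih =>
    choose K L f g hL hf hfg hg hK using h
    refine ⟨ModuleCat.of R (∀ i, K i), ModuleCat.of R (∀ i, L i), LinearMap.piMap f,
      LinearMap.piMap g, flat L hL, Function.Injective.piMap hf, fun x => ?_,
      Function.Surjective.piMap hg, ih hK⟩
    refine funext_iff.trans ((forall_congr' fun i => hfg i (x i)).trans ?_)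
    exact ⟨fun hx => ⟨fun i => (hx i).choose, funext fun i => (hx i).choose_spec⟩,
      fun ⟨y, hy⟩ i => ⟨y i, congrFun hy i⟩⟩

end HasFlatDimensionLE

/-- With enough projectives, vanishing of `Ext M Q (n + 1)` for every `M` already bounds the
injective dimension of `Q`; this makes the condition one on `Q` alone. -/
lemma isSGRing_iff (n : ℕ) (R : Type u) [CommRing R] :
    IsSGRing n R ↔
      (∀ M : ModuleCat.{u} R, HasSelfExtension (fun P => HasProjectiveDimensionLE P n) M) ∧
        ∀ Q : ModuleCat.{u} R, Module.Projective R Q → HasInjectiveDimensionLE Q n := by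
  refine ⟨fun h => ⟨fun M => (h M).1, fun Q hQ => ?_⟩, fun h M => ⟨h.1 M, fun Q hQ => ?_⟩⟩
  · exact hasInjectiveDimensionLT_of_enoughProjectives Q (n + 1) fun M => (h M).2 Q hQ
  · have := h.2 Q hQ
    exact HasInjectiveDimensionLT.subsingleton Q (n + 1) (n + 1) le_rfl M

lemma isWSGRing_iff (n : ℕ) (R : Type u) [CommRing R] :
    IsWSGRing n R ↔
      (∀ M : ModuleCat.{u} R, HasSelfExtension (HasFlatDimensionLE R n) M) ∧
        ∀ M I : ModuleCat.{u} R, Module.Injective R I →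
          IsZero (((Tor (ModuleCat.{u} R) (n + 1)).obj M).obj I) :=
  ⟨fun h => ⟨fun M => (h M).1, fun M => (h M).2⟩, fun h M => ⟨h.1 M, h.2 M⟩⟩

end SelfExtension

/-! ### Decomposition over a finite product of rings. -/

section Pi

open CategoryTheory.Limits TensorProduct

/-- The inclusion of a factor is a linear section of the projection of a product of rings. -/
def Pi.evalRingHomSection {ι : Type} [DecidableEq ι] (R : ι → Type u) [∀ i, CommRing (R i)]
    (i : ι) : (Pi.evalRingHom R i).LinearSection where
  toFun := AddMonoidHom.single R i
  map_mul r x := by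
    ext j
    obtain rfl | h := eq_or_ne j i <;> simp [*]
  apply_toFun x := by simp

variable {ι : Type} [DecidableEq ι] (R : ι → Type u) [∀ i, CommRing (R i)]

namespace ModuleCat

/-- The factor at `i` of a module over a product of rings, as a module over that product. -/
noncomputable abbrev piFactor (M : ModuleCat.{u} (∀ i, R i)) (i : ι) :
    ModuleCat.{u} (∀ i, R i) :=
  (restrictScalars (Pi.evalRingHom R i)).obj ((extendScalars (Pi.evalRingHom R i)).obj M)

/-- The projection to a factor. -/
noncomputable abbrev toPiFactor (M : ModuleCat.{u} (∀ i, R i)) (i : ι) : M ⟶ piFactor R M i :=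
  toExtend (Pi.evalRingHom R i) M

/-- The inclusion of a factor. -/
noncomputable abbrev fromPiFactor (M : ModuleCat.{u} (∀ i, R i)) (i : ι) : piFactor R M i ⟶ M :=
  (Pi.evalRingHomSection R i).fromExtend M

lemma fromPiFactor_comp_toPiFactor_of_ne (M : ModuleCat.{u} (∀ i, R i)) {i j : ι} (h : i ≠ j) :
    fromPiFactor R M i ≫ toPiFactor R M j = 0 := by
  let := (Pi.evalRingHom R i).toAlgebra
  ext z
  change (toPiFactor R M j).hom ((fromPiFactor R M i).hom z) = 0
  induction (show R i ⊗[∀ i, R i] M from z) using TensorProduct.induction_on with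
  | zero => exact (congrArg _ (map_zero _)).trans (map_zero _)
  | tmul x m =>
    let := (Pi.evalRingHom R j).toAlgebra
    change (1 : R j) ⊗ₜ[∀ i, R i] ((Pi.single i x : ∀ i, R i) • m) = 0
    -- The scalar supported at `i` moves to the `R j` side, where its component is zero.
    rw [← TensorProduct.smul_tmul, Algebra.smul_def, mul_one]
    change (Pi.single i x : ∀ i, R i) j ⊗ₜ[∀ i, R i] m = 0
    rw [Pi.single_eq_of_ne h.symm, TensorProduct.zero_tmul]
  | add z w hz hw =>
    refine (congrArg _ (map_add (fromPiFactor R M i).hom z w)).trans ((map_add _ _ _).trans ?_)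
    exact (congrArg₂ (· + ·) hz hw).trans (add_zero _)

variable [Fintype ι]

lemma sum_fromPiFactor_toPiFactor_apply (M : ModuleCat.{u} (∀ i, R i)) (m : M) :
    ∑ i, (fromPiFactor R M i).hom ((toPiFactor R M i).hom m) = m := by
  -- The round trip through a factor is multiplication by its idempotent, and the idempotents sum to
  -- 1.
  have h (i : ι) : (fromPiFactor R M i).hom ((toPiFactor R M i).hom m) =
      (Pi.single i 1 : ∀ i, R i) • m := rfl
  rw [Finset.sum_congr rfl fun i _ => h i, ← Finset.sum_smul]
  have : ∑ i, (Pi.single i 1 : ∀ i, R i) = 1 := Finset.univ_sum_single (1 : ∀ i, R i)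
  rw [this, one_smul]

lemma sum_toPiFactor_comp_fromPiFactor (M : ModuleCat.{u} (∀ i, R i)) :
    ∑ i, toPiFactor R M i ≫ fromPiFactor R M i = 𝟙 M := by
  ext m
  rw [hom_sum, LinearMap.sum_apply]
  exact sum_fromPiFactor_toPiFactor_apply R M m

/-- A module over a finite product of rings is the product of its factors. -/
noncomputable def piFactorEquiv (M : ModuleCat.{u} (∀ i, R i)) :
    M ≃ₗ[∀ i, R i] (∀ i, piFactor R M i) where
  __ := LinearMap.pi fun i => (toPiFactor R M i).hom
  invFun y := ∑ i, (fromPiFactor R M i).hom (y i)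
  left_inv := sum_fromPiFactor_toPiFactor_apply R M
  right_inv y := by
    ext j
    change (toPiFactor R M j).hom (∑ i, (fromPiFactor R M i).hom (y i)) = y j
    rw [map_sum, Finset.sum_eq_single j]
    · exact congrArg (fun g : piFactor R M j ⟶ piFactor R M j => g.hom (y j))
        ((Pi.evalRingHomSection R j).fromExtend_comp_toExtend M)
    · intro i _ h
      exact congrArg (fun g : piFactor R M i ⟶ piFactor R M j => g.hom (y i))
        (fromPiFactor_comp_toPiFactor_of_ne R M h)
    · simp

lemma hasProjectiveDimensionLE_pi {A : Type u} [CommRing A] (P : ι → ModuleCat.{u} A) (n : ℕ)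
    (h : ∀ i, HasProjectiveDimensionLE (P i) n) :
    HasProjectiveDimensionLE (ModuleCat.of A (∀ i, P i)) n := by
  refine hasProjectiveDimensionLE_of_sum_comp_eq_id (Y := P) (fun i => ofHom (LinearMap.proj i))
    (fun i => ofHom (LinearMap.single A (fun i => P i) i)) ?_ n h
  refine ModuleCat.hom_ext (LinearMap.ext fun x => ?_)
  rw [hom_sum, LinearMap.sum_apply]
  exact Finset.univ_sum_single x

lemma isZero_of_isZero_extendScalars (M : ModuleCat.{u} (∀ i, R i))
    (h : ∀ i, IsZero ((extendScalars (Pi.evalRingHom R i)).obj M)) : IsZero M := by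
  rw [isZero_iff_subsingleton]
  have (i : ι) : Subsingleton (piFactor R M i) := 
    isZero_iff_subsingleton.1 ((restrictScalars (Pi.evalRingHom R i)).map_isZero (h i))
  exact (piFactorEquiv R M).toEquiv.subsingleton

end ModuleCat

variable [Fintype ι]

lemma HasSelfExtension.of_extendScalars {T : ModuleCat.{u} (∀ i, R i) → Prop}
    {T' : ∀ i, ModuleCat.{u} (R i) → Prop}
    (hT' : ∀ i P, T' i P → T ((ModuleCat.restrictScalars (Pi.evalRingHom R i)).obj P))
    (hT : ∀ P : ι → ModuleCat.{u} (∀ i, R i), (∀ i, T (P i)) → T (ModuleCat.of _ (∀ i, P i)))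
    (M : ModuleCat.{u} (∀ i, R i))
    (h : ∀ i, HasSelfExtension (T' i) ((ModuleCat.extendScalars (Pi.evalRingHom R i)).obj M)) :
    HasSelfExtension T M :=
  (pi (fun i => (h i).map (ModuleCat.restrictScalars (Pi.evalRingHom R i)) (hT' i))
    hT).of_linearEquiv (ModuleCat.piFactorEquiv R M).symm

lemma HasSelfExtension.of_restrictScalars {A B : Type u} [CommRing A] [CommRing B] {f : A →+* B}
    (s : f.LinearSection) {T : ModuleCat.{u} A → Prop} {T' : ModuleCat.{u} B → Prop}
    (hT : ∀ P, T P → T' ((ModuleCat.extendScalars f).obj P)) (M : ModuleCat.{u} B)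
    (h : HasSelfExtension T ((ModuleCat.restrictScalars f).obj M)) : HasSelfExtension T' M := by
  have := s.preservesFiniteLimits_extendScalars
  have := s.preservesFiniteColimits_extendScalars
  have := (ModuleCat.extendRestrictScalarsAdj f).left_adjoint_additive
  obtain ⟨e⟩ := s.nonempty_extendScalars_restrictScalars_iso M
  exact (h.map (ModuleCat.extendScalars f) hT).of_linearEquiv e.toLinearEquiv

lemma isSGRing_pi_iff (n : ℕ) : IsSGRing n (∀ i, R i) ↔ ∀ i, IsSGRing n (R i) := by
  let s (i : ι) := Pi.evalRingHomSection R i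
  have h₁ (i : ι) := (s i).preservesFiniteLimits_extendScalars
  have h₂ (i : ι) := (s i).preservesFiniteColimits_extendScalars
  have h₃ (i : ι) := 
    (ModuleCat.extendRestrictScalarsAdj.{u} (Pi.evalRingHom R i)).left_adjoint_additive
  have h₄ (i : ι) := ModuleCat.preservesProjectiveObjects_extendScalars (Pi.evalRingHom R i)
  have h₅ (i : ι) := (s i).preservesInjectiveObjects_extendScalars
  have h₆ (i : ι) := (s i).preservesProjectiveObjects_restrictScalars
  have h₇ (i : ι) := ModuleCat.preservesInjectiveObjects_restrictScalars (f := Pi.evalRingHom R i)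
  simp only [isSGRing_iff]
  refine ⟨fun ⟨hM, hQ⟩ i => ⟨fun M => ?_, fun Q _ => ?_⟩, fun h => ⟨fun M => ?_, fun Q _ => ?_⟩⟩
  · exact .of_restrictScalars (s i)
      (fun P hP => (ModuleCat.extendScalars _).hasProjectiveDimensionLE_obj n P hP)
      M (hM _)
  -- Bound the injective dimension of `Q` over the product, then extend back to recover `Q`.
  · obtain ⟨e⟩ := (s i).nonempty_extendScalars_restrictScalars_iso Q
    have := hQ _ ((s i).projective_restrictScalars Q)
    have := (ModuleCat.extendScalars (Pi.evalRingHom R i)).hasInjectiveDimensionLE_obj n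
      ((ModuleCat.restrictScalars (Pi.evalRingHom R i)).obj Q) this
    exact hasInjectiveDimensionLT_of_iso e _
  · exact .of_extendScalars R
      (fun i P hP => (ModuleCat.restrictScalars _).hasProjectiveDimensionLE_obj n P hP)
      (fun P hP => ModuleCat.hasProjectiveDimensionLE_pi P n hP) M (fun i => (h i).1 _)
  · refine hasInjectiveDimensionLE_of_sum_comp_eq_id _ _
      (ModuleCat.sum_toPiFactor_comp_fromPiFactor R Q) n fun i => ?_
    have := (ModuleCat.extendScalars (Pi.evalRingHom R i)).projective_obj Q
    have := (h i).2 ((ModuleCat.extendScalars (Pi.evalRingHom R i)).obj Q)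
      (ModuleCat.projective_of_module_projective _)
    exact (ModuleCat.restrictScalars (Pi.evalRingHom R i)).hasInjectiveDimensionLE_obj n _ this

lemma isWSGRing_pi_iff (n : ℕ) : IsWSGRing n (∀ i, R i) ↔ ∀ i, IsWSGRing n (R i) := by
  let s (i : ι) := Pi.evalRingHomSection R i
  have h₁ (i : ι) := (s i).preservesFiniteLimits_extendScalars
  have h₂ (i : ι) := (s i).preservesFiniteColimits_extendScalars
  have h₃ (i : ι) := 
    (ModuleCat.extendRestrictScalarsAdj.{u} (Pi.evalRingHom R i)).left_adjoint_additive
  have h₄ (i : ι) := ModuleCat.preservesProjectiveObjects_extendScalars (Pi.evalRingHom R i)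
  have h₅ (i : ι) := (s i).preservesInjectiveObjects_extendScalars
  have h₇ (i : ι) := ModuleCat.preservesInjectiveObjects_restrictScalars (f := Pi.evalRingHom R i)
  simp only [isWSGRing_iff]
  refine ⟨fun ⟨hM, hI⟩ i => ⟨fun M => ?_, fun M I _ => ?_⟩, fun h => ⟨fun M => ?_, fun M I _ => ?_⟩⟩
  · exact .of_restrictScalars (s i)
      (fun P hP => hP.map (ModuleCat.extendScalars (Pi.evalRingHom R i))
        fun N _ => ModuleCat.flat_extendScalars _ N) M (hM _)
  -- The Tor of `M` and `I` is the extension of the Tor of their restrictions, which vanishes.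
  · obtain ⟨e⟩ := (s i).nonempty_extendScalars_restrictScalars_iso M
    obtain ⟨e'⟩ := (s i).nonempty_extendScalars_restrictScalars_iso I
    have : Injective I := Module.injective_object_of_injective_module (R i) I
    have := (ModuleCat.restrictScalars (Pi.evalRingHom R i)).injective_obj I
    have h := hI ((ModuleCat.restrictScalars (Pi.evalRingHom R i)).obj M)
      ((ModuleCat.restrictScalars (Pi.evalRingHom R i)).obj I)
      (Module.injective_module_of_injective_object _ _)
    obtain ⟨e''⟩ := (ModuleCat.extendScalars (Pi.evalRingHom R i)).nonempty_obj_tor_iso (n + 1)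
      ((ModuleCat.restrictScalars (Pi.evalRingHom R i)).obj M)
      ((ModuleCat.restrictScalars (Pi.evalRingHom R i)).obj I)
    exact ((ModuleCat.extendScalars (Pi.evalRingHom R i)).map_isZero h).of_iso
      (e'' ≪≫ ((Tor _ (n + 1)).mapIso e).app _ ≪≫ ((Tor _ (n + 1)).obj M).mapIso e').symm
  · exact .of_extendScalars R
      (fun i P hP => hP.map (ModuleCat.restrictScalars (Pi.evalRingHom R i))
        fun N _ => (s i).flat_restrictScalars N)
      (fun P hP => HasFlatDimensionLE.pi hP) M (fun i => (h i).1 _)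
  · refine ModuleCat.isZero_of_isZero_extendScalars R _ fun i => ?_
    have : Injective I := Module.injective_object_of_injective_module (∀ i, R i) I
    have := (ModuleCat.extendScalars (Pi.evalRingHom R i)).injective_obj I
    obtain ⟨e⟩ := (ModuleCat.extendScalars (Pi.evalRingHom R i)).nonempty_obj_tor_iso (n + 1) M I
    exact ((h i).2 _ _ (Module.injective_module_of_injective_object _ _)).of_iso e

end Pi

theorem theorem2p8 (n m : ℕ) (R : Fin m → Type u) [∀ i, CommRing (R i)] :
    (IsSGRing n (∀ i, R i) ↔ ∀ i, IsSGRing n (R i)) ∧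
      ((∀ i, IsCoherentRing (R i)) →
        (IsWSGRing n (∀ i, R i) ↔ ∀ i, IsWSGRing n (R i))) :=
  ⟨isSGRing_pi_iff R n, fun _ => isWSGRing_pi_iff R n⟩
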